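/- Let $N=\{1,\dots,n\}$ be a set of agents and $G$ a finite set of goods, and let every agent $i$ have a valuation $v_i:2^G\to\mathbb R$ that is a matroid rank function: $v_i(\emptyset)=0$; the marginal gain $\Delta_i(S,g)=v_i(S\cup\{g\})-v_i(S)$ lies in $\{0,1\}$ for all $S\subseteq G$ and $g\in G$; and $\Delta_i(S,g)\ge\Delta_i(T,g)$ whenever $S\subseteq T\subseteq G$ and $g\in G$. An allocation $X=(X_0,X_1,\dots,X_n)$ is a partition of $G$ into $n+1$ possibly empty bundles, where agent $i\in N$ owns $X_i$ and $X_0$ is the set of unallocated goods; put $v_0(S)=|S|$. The utility vector of $X$ is $\vec u^X=(v_1(X_1),\dots,v_n(X_n))$, and its utilitarian social welfare is $\sum_{i\in N}v_i(X_i)$. The exchange graph $\mathcal G(X)$ is the directed graph on $G$ that has an edge from $g\in X_k$ ($k\in\{0,\dots,n\}$) to another good $g'$ if and only if $v_k((X_k\setminus\{g\})\cup\{g'\})=v_k(X_k)$. Put $F_i(X)=\{g\in G:\Delta_i(X_i,g)=1\}$. A gain function is any map $\phi$ that assigns to a utility vector $\vec u$ and an agent $i$ a vector $\phi(\vec u,i)\in\mathbb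 R^b$; such vectors are compared lexicographically. General Yankee Swap with gain function $\phi$ starts with $X=(G,\emptyset,\dots,\emptyset)$ and $U=N$ and repeats the following as long as $U\ne\emptyset$. Let $i$ be the agent of least index among those $k\in U$ that maximize $\phi(\vec u^X,k)$. If $\mathcal G(X)$ has a path from $F_i(X)$ to $X_0$, take any shortest such path $(g_1,\dots,g_t)$ and, simultaneously, give $g_1$ to $i$ and $g_{j+1}$ to the owner of $g_j$ under $X$ for every $1\le j<t$; otherwise remove $i$ from $U$. When $U=\emptyset$, the output is $X$. Then for every gain function $\phi$, however ties between shortest paths are broken, General Yankee Swap terminates, it has an output, and every output $X$ maximizes utilitarian social welfare: $\sum_{i\in N}v_i(Y_i)\le\sum_{i\in N}v_i(X_i)$ for every allocation $Y$. -/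

import Mathlib

namespace YankeeSwap

/-- `f` is a matroid rank function (binary submodular valuation) on the finite set of goods `G`. -/
structure IsMatroidRank {G : Type*} [DecidableEq G] (f : Finset G → ℝ) : Prop where
  map_empty : f ∅ = 0
  marginal_binary : ∀ (S : Finset G) (g : G), f (insert g S) - f S = 0 ∨ f (insert g S) - f S = 1
  marginal_antitone : ∀ (S T : Finset G) (g : G), S ⊆ T →
    f (insert g T) - f T ≤ f (insert g S) - f S

/-- An allocation, i.e. a partition of the goods into `n + 1` labelled (possibly empty) bundles
`X₀, X₁, …, Xₙ`, given by the map sending every good to its owner. The value `some i` means that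
agent `i` owns the good, and `none` (the "agent `0`") means that the good is unallocated. -/
abbrev Allocation (n : ℕ) (G : Type*) := G → Option (Fin n)

section

variable {n : ℕ} {G : Type*} [Fintype G] [DecidableEq G]

/-- The bundle of `k`, where `k = none` gives the set of unallocated goods. -/
def bundle (X : Allocation n G) (k : Option (Fin n)) : Finset G :=
  Finset.univ.filter fun g => X g = k

/-- The valuations of all agents including the agent `0`, which values a bundle by its size. -/
def extVal (v : Fin n → Finset G → ℝ) : Option (Fin n) → Finset G → ℝ
  | none => fun S => (S.card : ℝ)
  | some i => v i

/-- The utility vector of an allocation. -/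
def utility (v : Fin n → Finset G → ℝ) (X : Allocation n G) : Fin n → ℝ :=
  fun i => v i (bundle X (some i))

/-- Utilitarian social welfare. -/
def usw (v : Fin n → Finset G → ℝ) (X : Allocation n G) : ℝ :=
  ∑ i, utility v X i

/-- `X` maximizes utilitarian social welfare among all allocations. -/
def IsMaxUSW (v : Fin n → Finset G → ℝ) (X : Allocation n G) : Prop :=
  ∀ Y : Allocation n G, usw v Y ≤ usw v X

/-- The edge relation of the exchange graph of `X`: the owner of `g` can replace `g` by another
good `g'` without a change in value. -/
def ExchangeEdge (v : Fin n → Finset G → ℝ) (X : Allocation n G) (g g' : G) : Prop :=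
  g' ≠ g ∧
    extVal v (X g) (insert g' ((bundle X (X g)).erase g)) = extVal v (X g) (bundle X (X g))

/-- The set of goods that give agent `i` a marginal gain of one. -/
def desired (v : Fin n → Finset G → ℝ) (X : Allocation n G) (i : Fin n) : Set G :=
  {g | v i (insert g (bundle X (some i))) - v i (bundle X (some i)) = 1}

/-- `P` is a path in the exchange graph from the goods desired by `i` to the unallocated goods. -/
def IsTransferPath (v : Fin n → Finset G → ℝ) (X : Allocation n G) (i : Fin n)
    (P : List G) : Prop :=
  P.IsChain (ExchangeEdge v X) ∧
    ∃ h : P ≠ [], P.head h ∈ desired v X i ∧ P.getLast h ∈ bundle X none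

/-- `P` is a shortest such path. -/
def IsShortestTransferPath (v : Fin n → Finset G → ℝ) (X : Allocation n G) (i : Fin n)
    (P : List G) : Prop :=
  IsTransferPath v X i P ∧ ∀ Q : List G, IsTransferPath v X i Q → P.length ≤ Q.length

/-- `transfer X k [g₁, …, gₜ]` gives `g₁` to `k` and each later good `gⱼ₊₁` to the owner of `gⱼ`
under `X`; all the other goods stay where they are. -/
def transfer (X : Allocation n G) : Option (Fin n) → List G → Allocation n G
  | _, [] => X
  | k, g :: P => Function.update (transfer X (X g) P) g k

/-- Path augmentation along `P`, where the first good of `P` is given to agent `i`. -/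
def augment (X : Allocation n G) (i : Fin n) (P : List G) : Allocation n G :=
  transfer X (some i) P

/-- The state of General Yankee Swap: the current allocation `X` and the set `U` of agents that
are still playing. -/
structure State (n : ℕ) (G : Type*) where
  alloc : Allocation n G
  active : Finset (Fin n)

/-- Initially all the goods are unallocated and all the agents are playing. -/
def initial (n : ℕ) (G : Type*) : State n G where
  alloc := fun _ => none
  active := Finset.univ

/-- `i` is the agent of least index among the agents in `U` that maximize the gain `φ(u, ·)`,
where vectors are compared lexicographically and `u` is the current utility vector. -/
def IsChosen {b : ℕ} (v : Fin n → Finset G → ℝ) (φ : (Fin n → ℝ) → Fin n → Fin b → ℝ)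
    (s : State n G) (i : Fin n) : Prop :=
  IsLeast {k | k ∈ s.active ∧ ∀ j ∈ s.active,
    toLex (φ (utility v s.alloc) j) ≤ toLex (φ (utility v s.alloc) k)} i

/-- One iteration of the loop of General Yankee Swap. There is no rule on which of several
shortest paths is taken, so this is a relation. -/
inductive Step {b : ℕ} (v : Fin n → Finset G → ℝ) (φ : (Fin n → ℝ) → Fin n → Fin b → ℝ) :
    State n G → State n G → Prop
  | swap (s : State n G) (i : Fin n) (P : List G) (hi : IsChosen v φ s i)
      (hP : IsShortestTransferPath v s.alloc i P) :
      Step v φ s ⟨augment s.alloc i P, s.active⟩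
  | remove (s : State n G) (i : Fin n) (hi : IsChosen v φ s i)
      (hP : ¬ ∃ P : List G, IsTransferPath v s.alloc i P) :
      Step v φ s ⟨s.alloc, s.active.erase i⟩

/-- `X` is a possible output of General Yankee Swap: some run reaches `X` with `U = ∅`. -/
def IsOutput {b : ℕ} (v : Fin n → Finset G → ℝ) (φ : (Fin n → ℝ) → Fin n → Fin b → ℝ)
    (X : Allocation n G) : Prop :=
  Relation.ReflTransGen (Step v φ) (initial n G) ⟨X, ∅⟩

end

end YankeeSwap

/-! Two facts persist along every run: each bundle is independent (its value is its size), and every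
good desired by a removed agent lies in the set `A` of goods that cannot reach an unallocated good
(`stuck`). Neither depends on how `φ` selects agents.

Independence survives because a shortest path has no shortcuts, so its exchanges can be carried out
one at a time from the far end (`IsInducedTransferPath.augment`). Removal is final because
augmenting paths avoid `A`, and `A` stays closed under exchange edges
(`desired_augment_subset_stuck`).

Once all agents are removed, `A` certifies optimality as in matroid union: `v k Aᶜ ≤ |X_k \ A|` for
every `k`, and all of `A` is allocated, so any `Y` has welfare at most `∑ |X_k \ A| + |A|`, which
`X` attains. -/

namespace YankeeSwap

/-! ### Matroid rank functions: independence, closure, exchange -/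

namespace IsMatroidRank

variable {G : Type*} [DecidableEq G] {f : Finset G → ℝ}

theorem le_insert (hf : IsMatroidRank f) (S : Finset G) (g : G) : f S ≤ f (insert g S) := by
  rcases hf.marginal_binary S g with h | h <;> linarith

theorem insert_le (hf : IsMatroidRank f) (S : Finset G) (g : G) : f (insert g S) ≤ f S + 1 := by
  rcases hf.marginal_binary S g with h | h <;> linarith

theorem le_union (hf : IsMatroidRank f) (S T : Finset G) : f S ≤ f (S ∪ T) := by
  induction T using Finset.induction_on with
  | empty => simp
  | insert g T _ ih =>
    rw [Finset.union_insert]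
    exact ih.trans (hf.le_insert _ _)

theorem mono (hf : IsMatroidRank f) {S T : Finset G} (h : S ⊆ T) : f S ≤ f T := by
  simpa [Finset.union_eq_right.2 h] using hf.le_union S T

theorem union_le_add_card (hf : IsMatroidRank f) (S T : Finset G) :
    f (S ∪ T) ≤ f S + T.card := by
  induction T using Finset.induction_on with
  | empty => simp
  | insert g T hg ih =>
    rw [Finset.union_insert, Finset.card_insert_of_notMem hg]
    push_cast
    linarith [hf.insert_le (S ∪ T) g]

theorem le_card (hf : IsMatroidRank f) (S : Finset G) : f S ≤ S.card := by
  simpa [hf.map_empty] using hf.union_le_add_card ∅ S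

theorem le_sdiff_add_card_inter (hf : IsMatroidRank f) (S A : Finset G) :
    f S ≤ f (S \ A) + (S ∩ A).card := by
  simpa [Finset.sdiff_union_inter] using hf.union_le_add_card (S \ A) (S ∩ A)

theorem eq_card_of_subset (hf : IsMatroidRank f) {S T : Finset G} (h : S ⊆ T)
    (hT : f T = T.card) : f S = S.card := by
  have h1 := hf.union_le_add_card S (T \ S)
  rw [Finset.union_sdiff_of_subset h] at h1
  have h2 : ((T \ S).card : ℝ) + S.card = T.card := by
    exact_mod_cast Finset.card_sdiff_add_card_eq_card h
  linarith [hf.le_card S]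

theorem marginal_union_antitone (hf : IsMatroidRank f) {R T : Finset G} (h : R ⊆ T)
    (S : Finset G) : f (T ∪ S) - f T ≤ f (R ∪ S) - f R := by
  induction S using Finset.induction_on with
  | empty => simp
  | insert g S _ ih =>
    rw [Finset.union_insert, Finset.union_insert]
    linarith [hf.marginal_antitone (R ∪ S) (T ∪ S) g (Finset.union_subset_union_left h)]

theorem union_eq_of_forall_insert_eq (hf : IsMatroidRank f) (S T : Finset G)
    (h : ∀ g ∈ T, f (insert g S) = f S) : f (S ∪ T) = f S := by
  induction T using Finset.induction_on with
  | empty => simp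
  | insert g T _ ih =>
    rw [Finset.union_insert]
    have h1 := ih fun x hx => h x (Finset.mem_insert_of_mem hx)
    have h2 := h g (Finset.mem_insert_self _ _)
    have h3 := hf.marginal_antitone S (S ∪ T) g Finset.subset_union_left
    linarith [hf.le_insert (S ∪ T) g]

/-- Sets of equal rank, one inside the other, have the same closure. -/
theorem insert_eq_of_subset_of_eq (hf : IsMatroidRank f) {S T : Finset G} (h : S ⊆ T)
    (hST : f S = f T) (g : G) : f (insert g S) = f (insert g T) := by
  linarith [hf.marginal_antitone S T g h, hf.mono (Finset.insert_subset_insert g h)]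

/-- Both `I` and `I - a + b` lie in `I + b` and have its rank, so all three have the same closure.
-/
theorem insert_exchange_eq (hf : IsMatroidRank f) {I : Finset G} {a b : G}
    (hab : f (insert b (I.erase a)) = f I) (hb : f (insert b I) = f I) (g : G) :
    f (insert g (insert b (I.erase a))) = f (insert g I) := by
  rw [hf.insert_eq_of_subset_of_eq
      (Finset.insert_subset_insert b (Finset.erase_subset a I)) (hab.trans hb.symm) g,
    hf.insert_eq_of_subset_of_eq (Finset.subset_insert b I) hb.symm g]

theorem insert_erase_eq_of_ne (hf : IsMatroidRank f) {I : Finset G} (hI : f I = I.card)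
    {b x : G} (hx : x ∈ I) (h : f (insert b (I.erase x)) ≠ f I) :
    f (insert b (I.erase x)) = f (I.erase x) := by
  have h1 := hf.eq_card_of_subset (Finset.erase_subset x I) hI
  have h2 : ((I.erase x).card : ℝ) + 1 = I.card := by
    exact_mod_cast Finset.card_erase_add_one hx
  rcases hf.marginal_binary (I.erase x) b with h3 | h3
  · linarith
  · exact absurd (by linarith) h

/-- Exchanging `a` for `b` does not change which goods `x` can be exchanged for, provided that
`x` cannot be exchanged for `b`. -/
theorem insert_erase_exchange_eq (hf : IsMatroidRank f) {I : Finset G} (hI : f I = I.card)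
    {a b x : G} (ha : a ∈ I) (hb : b ∉ I) (hx : x ∈ I) (hxa : x ≠ a)
    (hab : f (insert b (I.erase a)) = f I) (hxb : f (insert b (I.erase x)) ≠ f I) (g : G) :
    f (insert g ((insert b (I.erase a)).erase x)) = f (insert g (I.erase x)) := by
  have hbx : b ≠ x := fun h => hb (h ▸ hx)
  have h0 := hf.insert_erase_eq_of_ne hI hx hxb
  have hcard : (insert b (I.erase a)).card = I.card := by
    rw [Finset.card_insert_of_notMem (fun h => hb (Finset.mem_of_mem_erase h)),
      Finset.card_erase_add_one ha]
  have hJ : f (insert b (I.erase a)) = (insert b (I.erase a)).card := by rw [hcard, hab, hI]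
  have hxJ : x ∈ insert b (I.erase a) := by simp [hx, hxa]
  have h1 := hf.eq_card_of_subset (Finset.erase_subset x _) hJ
  have h2 := hf.eq_card_of_subset (Finset.erase_subset x I) hI
  have h3 : ((insert b (I.erase a)).erase x).card = (I.erase x).card := by
    rw [Finset.card_erase_of_mem hxJ, Finset.card_erase_of_mem hx, hcard]
  -- The exchanged set without `x` and `I - x` both lie in `I - x + b`, and all three have rank `|I|
  -- - 1`; hence they have equal closures.
  have hsub : (insert b (I.erase a)).erase x ⊆ insert b (I.erase x) := by
    intro y
    simp only [Finset.mem_erase, Finset.mem_insert]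
    tauto
  rw [hf.insert_eq_of_subset_of_eq hsub (by rw [h0, h1, h2, h3]),
    hf.insert_eq_of_subset_of_eq (Finset.subset_insert b (I.erase x)) h0.symm]

/-- The hypothesis puts `g` in the closure of `I - x` for each `x ∈ D`. For independent `I`, the
intersection of these closures is the closure of `I \ D`; the elements of `D` are removed one at a
time by submodularity. -/
theorem insert_sdiff_eq (hf : IsMatroidRank f) {I D : Finset G} (hI : f I = I.card)
    (hDI : D ⊆ I) (hD : D.Nonempty) {g : G}
    (h : ∀ x ∈ D, f (insert g (I.erase x)) ≠ f I) : f (insert g (I \ D)) = f (I \ D) := by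
  induction hD using Finset.Nonempty.cons_induction with
  | singleton x =>
    rw [Finset.sdiff_singleton_eq_erase]
    exact hf.insert_erase_eq_of_ne hI (hDI (Finset.mem_singleton_self x))
      (h x (Finset.mem_singleton_self x))
  | cons x D hx _ ih =>
    rw [Finset.cons_eq_insert] at *
    have hxI : x ∈ I := hDI (Finset.mem_insert_self x D)
    have ih' := ih ((Finset.subset_insert x D).trans hDI)
      fun y hy => h y (Finset.mem_insert_of_mem hy)
    have h0 := hf.insert_erase_eq_of_ne hI hxI (h x (Finset.mem_insert_self x D))
    have hsub : insert g (I \ insert x D) ⊆ insert g (I \ D) :=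
      Finset.insert_subset_insert g (Finset.sdiff_subset_sdiff subset_rfl (Finset.subset_insert x D))
    have h1 := hf.marginal_union_antitone hsub (I.erase x)
    have h2 : insert g (I \ D) ∪ I.erase x = insert g I := by
      ext y
      by_cases hy : y = x
      · subst hy; simp [hx, hxI]
      · simp only [Finset.mem_union, Finset.mem_insert, Finset.mem_sdiff, Finset.mem_erase]
        tauto
    have h3 : insert g (I \ insert x D) ∪ I.erase x = insert g (I.erase x) := by
      ext y
      simp only [Finset.mem_union, Finset.mem_insert, Finset.mem_sdiff, Finset.mem_erase]
      tauto
    have h4 : I \ insert x D = (I \ D).erase x := by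
      ext y
      simp only [Finset.mem_insert, Finset.mem_sdiff, Finset.mem_erase]
      tauto
    have h5 : (((I \ insert x D).card : ℕ) : ℝ) + 1 = (I \ D).card := by
      rw [h4]
      exact_mod_cast Finset.card_erase_add_one (Finset.mem_sdiff.2 ⟨hxI, hx⟩)
    have h6 : ((I.erase x).card : ℝ) + 1 = I.card := by
      exact_mod_cast Finset.card_erase_add_one hxI
    have h7 := hf.eq_card_of_subset (Finset.sdiff_subset (s := I) (t := D)) hI
    have h8 := hf.eq_card_of_subset (Finset.sdiff_subset (s := I) (t := insert x D)) hI
    have h9 := hf.eq_card_of_subset (Finset.erase_subset x I) hI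
    rw [h2, h3] at h1
    linarith [hf.le_insert (I \ insert x D) g, hf.le_insert I g]

end IsMatroidRank

/-! ### Augmentation along shortest paths -/

variable {n : ℕ} {G : Type*} {v : Fin n → Finset G → ℝ}
  {X : Allocation n G} {i : Fin n}

@[simp]
theorem mem_bundle [Fintype G] {k : Option (Fin n)} {g : G} : g ∈ bundle X k ↔ X g = k := by
  simp [bundle]

variable [DecidableEq G]

theorem transfer_of_notMem {g : G} : ∀ {P : List G} {k : Option (Fin n)}, g ∉ P →
    transfer X k P g = X g
  | [], _, _ => rfl
  | a :: P, k, h => by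
    simp only [List.mem_cons, not_or] at h
    rw [transfer, Function.update_of_ne h.1, transfer_of_notMem h.2]

/-- The owner of `a` takes `b`, and `a` becomes unallocated. -/
def swapLast (X : Allocation n G) (a b : G) : Allocation n G :=
  Function.update (Function.update X a none) b (X a)

theorem swapLast_of_ne {a b g : G} (ha : g ≠ a) (hb : g ≠ b) : swapLast X a b g = X g := by
  simp [swapLast, ha, hb]

/-- Performing the last exchange first allows induction on the length of the path. -/
theorem transfer_append_pair {a b : G} (hab : a ≠ b) : ∀ {Q : List G} {k : Option (Fin n)},
    a ∉ Q → b ∉ Q → transfer X k (Q ++ [a, b]) = transfer (swapLast X a b) k (Q ++ [a])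
  | [], k, _, _ => by
    simp only [List.nil_append, transfer, swapLast]
    ext g : 1
    by_cases hga : g = a
    · simp [hga]
    · by_cases hgb : g = b
      · subst hgb; simp [hga]
      · simp [hga, hgb]
  | g :: Q, k, ha, hb => by
    simp only [List.mem_cons, not_or] at ha hb
    rw [List.cons_append, List.cons_append, transfer, transfer,
      transfer_append_pair hab ha.2 hb.2, swapLast_of_ne (Ne.symm ha.1) (Ne.symm hb.1)]

variable [Fintype G]

/-- Every agent values the own bundle at its size. -/
def NonRedundant (v : Fin n → Finset G → ℝ) (X : Allocation n G) : Prop :=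
  ∀ k, v k (bundle X (some k)) = (bundle X (some k)).card

theorem exchangeEdge_iff {g g' : G} {k : Fin n} (hg : X g = some k) :
    ExchangeEdge v X g g' ↔ g' ≠ g ∧
      v k (insert g' ((bundle X (some k)).erase g)) = v k (bundle X (some k)) := by
  simp [ExchangeEdge, hg, extVal]

/-- A transfer path without repetitions and shortcuts. -/
structure IsInducedTransferPath (v : Fin n → Finset G → ℝ) (X : Allocation n G) (i : Fin n)
    (P : List G) : Prop where
  head : ∀ a R, P = a :: R → a ∈ desired v X i ∧ ∀ x ∈ R, x ∉ desired v X i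
  last : ∀ Q a, P = Q ++ [a] → X a = none ∧ ∀ x ∈ Q, X x ≠ none
  edge : ∀ Q a b R, P = Q ++ a :: b :: R →
    ExchangeEdge v X a b ∧ ∀ x ∈ Q, ¬ ExchangeEdge v X x b

/-- A later desired good, an earlier unallocated good or an edge that skips ahead would each yield a
strictly shorter path. Unlike minimality among all paths, these local conditions are easily
rechecked after an exchange. -/
theorem IsShortestTransferPath.isInduced {P : List G} (h : IsShortestTransferPath v X i P) :
    IsInducedTransferPath v X i P := by
  obtain ⟨⟨hc, hne, hh, hl⟩, hmin⟩ := h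
  refine ⟨?_, ?_, ?_⟩
  · rintro a R rfl
    refine ⟨hh, fun x hx hd => ?_⟩
    obtain ⟨s, t, rfl⟩ := List.append_of_mem hx
    have hc' : (x :: t).IsChain (ExchangeEdge v X) :=
      (List.isChain_split.1 (by simpa using hc : ((a :: s) ++ x :: t).IsChain _)).2
    have := hmin (x :: t) ⟨hc', by simp, by simpa using hd, by
      simpa [List.getLast_append] using hl⟩
    simp at this
    omega
  · rintro Q a rfl
    refine ⟨by simpa using hl, fun x hx hd => ?_⟩
    obtain ⟨s, t, rfl⟩ := List.append_of_mem hx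
    have hc' : (s ++ [x]).IsChain (ExchangeEdge v X) :=
      (List.isChain_split.1 (by simpa using hc : (s ++ x :: (t ++ [a])).IsChain _)).1
    have := hmin (s ++ [x]) ⟨hc', by simp, by cases s <;> simpa using hh, by simpa using hd⟩
    simp at this
  · rintro Q a b R rfl
    refine ⟨(List.isChain_append_cons_cons.1 hc).2.1, fun x hx he => ?_⟩
    obtain ⟨s, t, rfl⟩ := List.append_of_mem hx
    have h1 : (s ++ [x]).IsChain (ExchangeEdge v X) :=
      (List.isChain_split.1 (by simpa using hc : (s ++ x :: (t ++ a :: b :: R)).IsChain _)).1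
    have h2 := (List.isChain_append_cons_cons.1 hc).2.2
    have := hmin (s ++ x :: b :: R) ⟨List.isChain_append_cons_cons.2 ⟨h1, he, h2⟩, by simp,
      by cases s <;> simpa using hh, by simpa [List.getLast_append] using hl⟩
    simp at this
    omega

theorem bundle_swapLast_self {a b : G} {k : Fin n} (ha : X a = some k) (hb : X b = none) :
    bundle (swapLast X a b) (some k) = insert b ((bundle X (some k)).erase a) := by
  ext g
  by_cases hga : g = a
  · subst hga
    have : g ≠ b := fun h => by simp [h, hb] at ha
    simp [swapLast, this]
  · by_cases hgb : g = b
    · subst hgb; simp [swapLast, ha]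
    · simp [swapLast_of_ne hga hgb, hga, hgb]

theorem bundle_swapLast_of_ne {a b : G} {k l : Fin n} (ha : X a = some k) (hb : X b = none)
    (hkl : l ≠ k) : bundle (swapLast X a b) (some l) = bundle X (some l) := by
  ext g
  by_cases hgb : g = b
  · subst hgb; simp [swapLast, ha, hb, hkl.symm]
  · by_cases hga : g = a
    · subst hga; simp [swapLast, hgb, ha, hkl.symm]
    · simp [swapLast_of_ne hga hgb]

theorem card_bundle_swapLast {a b : G} {k : Fin n} (ha : X a = some k) (hb : X b = none)
    (l : Fin n) : (bundle (swapLast X a b) (some l)).card = (bundle X (some l)).card := by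
  by_cases hl : l = k
  · subst hl
    rw [bundle_swapLast_self ha hb, Finset.card_insert_of_notMem (by simp [hb]),
      Finset.card_erase_add_one (by simpa using ha)]
  · rw [bundle_swapLast_of_ne ha hb hl]

theorem NonRedundant.swapLast (hX : NonRedundant v X) {a b : G} {k : Fin n} (ha : X a = some k)
    (hb : X b = none) (hab : ExchangeEdge v X a b) : NonRedundant v (swapLast X a b) := by
  intro l
  rw [card_bundle_swapLast ha hb]
  by_cases hl : l = k
  · subst hl
    rw [bundle_swapLast_self ha hb, ((exchangeEdge_iff ha).1 hab).2, hX]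
  · rw [bundle_swapLast_of_ne ha hb hl, hX]

/-- Since `b` is not desired by `i`, trading `a` for `b` preserves the closure of the bundle of `i`
if `i` owns `a`; otherwise that bundle is unchanged. -/
theorem desired_swapLast (hv : ∀ k, IsMatroidRank (v k)) {a b : G}
    {k : Fin n} (ha : X a = some k) (hb : X b = none) (hab : ExchangeEdge v X a b)
    (hbi : b ∉ desired v X i) : desired v (swapLast X a b) i = desired v X i := by
  by_cases hi : i = k
  · subst hi
    have hab' := ((exchangeEdge_iff ha).1 hab).2
    have hbI : v i (insert b (bundle X (some i))) = v i (bundle X (some i)) := by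
      rcases (hv i).marginal_binary (bundle X (some i)) b with h | h
      · linarith
      · exact absurd h hbi
    ext g
    simp only [desired, Set.mem_ofPred_eq, bundle_swapLast_self ha hb, hab',
      (hv i).insert_exchange_eq hab' hbI g]
  · simp only [desired, bundle_swapLast_of_ne ha hb hi]

theorem exchangeEdge_swapLast_iff (hv : ∀ k, IsMatroidRank (v k)) (hX : NonRedundant v X)
    {a b x : G} {k l : Fin n} (ha : X a = some k) (hb : X b = none)
    (hab : ExchangeEdge v X a b) (hx : X x = some l) (hxa : x ≠ a)
    (hxb : ¬ ExchangeEdge v X x b) (g : G) :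
    ExchangeEdge v (swapLast X a b) x g ↔ ExchangeEdge v X x g := by
  have hbx : b ≠ x := fun h => by simp [h, hx] at hb
  have hx' : swapLast X a b x = some l := by rw [swapLast_of_ne hxa hbx.symm, hx]
  rw [exchangeEdge_iff hx', exchangeEdge_iff hx]
  by_cases hl : l = k
  · subst hl
    have hab' := ((exchangeEdge_iff ha).1 hab).2
    rw [exchangeEdge_iff hx] at hxb
    rw [bundle_swapLast_self ha hb, hab',
      (hv l).insert_erase_exchange_eq (hX l) (by simpa using ha) (by simp [hb])
        (by simpa using hx) hxa hab' (fun h => hxb ⟨hbx, h⟩)]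
  · rw [bundle_swapLast_of_ne ha hb hl]

/-- No good of `Q` has an edge to `b`, so the edges out of `Q` are unaffected by the exchange, and
`a` becomes the unallocated end of the path. -/
theorem IsInducedTransferPath.swapLast (hv : ∀ k, IsMatroidRank (v k)) (hX : NonRedundant v X)
    {Q : List G} {a b : G} (h : IsInducedTransferPath v X i (Q ++ [a, b])) :
    IsInducedTransferPath v (swapLast X a b) i (Q ++ [a]) := by
  obtain ⟨hhead, hlast, hedge⟩ := h
  obtain ⟨hb, hown⟩ := hlast (Q ++ [a]) b (by simp)
  obtain ⟨hab, hQb⟩ := hedge Q a b [] rfl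
  obtain ⟨k, ha⟩ := Option.ne_none_iff_exists'.1 (hown a (by simp))
  have haQ : a ∉ Q := fun h => hQb a h hab
  have hbQ : b ∉ Q := fun h => hown b (by simp [h]) hb
  have hab' : a ≠ b := fun h => by simp [h, hb] at ha
  have hbd : b ∉ desired v X i := by
    cases Q with
    | nil => exact (hhead a [b] rfl).2 b (by simp)
    | cons c Q => exact (hhead c (Q ++ [a, b]) rfl).2 b (by simp)
  have hd := desired_swapLast (i := i) hv ha hb hab hbd
  have hE : ∀ x ∈ Q, ∀ g, ExchangeEdge v (YankeeSwap.swapLast X a b) x g ↔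
      ExchangeEdge v X x g := by
    intro x hx g
    obtain ⟨l, hl⟩ := Option.ne_none_iff_exists'.1 (hown x (by simp [hx]))
    exact exchangeEdge_swapLast_iff hv hX ha hb hab hl (fun h => haQ (h ▸ hx)) (hQb x hx) g
  refine ⟨?_, ?_, ?_⟩
  · intro c R hR
    rw [hd]
    obtain ⟨h1, h2⟩ := hhead c (R ++ [b]) (by rw [← List.cons_append, ← hR]; simp)
    exact ⟨h1, fun x hx => h2 x (by simp [hx])⟩
  · intro Q' c hQ'
    obtain ⟨rfl, hc⟩ := List.append_inj' hQ' rfl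
    simp only [List.cons.injEq, and_true] at hc
    subst hc
    refine ⟨by simp [YankeeSwap.swapLast, hab'], fun x hx => ?_⟩
    rw [swapLast_of_ne (ne_of_mem_of_not_mem hx haQ) (ne_of_mem_of_not_mem hx hbQ)]
    exact hown x (by simp [hx])
  · intro Q' c d R hQ'
    obtain ⟨h1, h2⟩ := hedge Q' c d (R ++ [b]) (by
      have := congrArg (· ++ [b]) hQ'
      simpa using this)
    -- Since `c` has a successor in `Q ++ [a]`, it and its predecessors sit in `Q`.
    have hsub : ∀ x ∈ Q' ++ [c], x ∈ Q := by
      intro x hx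
      have h3 : Q = (Q' ++ c :: d :: R).dropLast := by rw [← hQ']; simp
      rw [h3, List.dropLast_append_of_ne_nil (by simp)]
      simp at hx ⊢
      tauto
    exact ⟨(hE c (hsub c (by simp)) d).2 h1, fun x hx => by
      rw [hE x (hsub x (by simp [hx])) d]
      exact h2 x hx⟩

theorem bundle_update_self {a : G} (k : Option (Fin n)) :
    bundle (Function.update X a k) k = insert a (bundle X k) := by
  ext g
  by_cases hga : g = a
  · subst hga; simp
  · simp [hga]

theorem bundle_update_of_ne {a : G} {k l : Option (Fin n)} (ha : X a ≠ l) (hkl : k ≠ l) :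
    bundle (Function.update X a k) l = bundle X l := by
  ext g
  by_cases hga : g = a
  · subst hga; simp [hkl, ha]
  · simp [hga]

/-- The last exchange keeps all bundle sizes and leaves a shorter induced path. A path of one good
is an unallocated good desired by `i`. -/
theorem IsInducedTransferPath.augment (hv : ∀ k, IsMatroidRank (v k)) :
    ∀ {P : List G} {X : Allocation n G}, NonRedundant v X → P ≠ [] →
      IsInducedTransferPath v X i P → NonRedundant v (augment X i P) ∧
      ∀ k, (bundle (augment X i P) (some k)).card =
        (bundle X (some k)).card + if k = i then 1 else 0 := by
  intro P
  induction hm : P.length using Nat.strong_induction_on generalizing P with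
  | _ m ih =>
  intro X hX hne h
  obtain ⟨P', b, rfl⟩ := List.eq_nil_or_concat' P |>.resolve_left hne
  rcases List.eq_nil_or_concat' P' with rfl | ⟨Q, a, rfl⟩
  · have hb := (h.last [] b rfl).1
    have hd := (h.head b [] rfl).1
    have hcard : ∀ k, (bundle (YankeeSwap.augment X i [b]) (some k)).card =
        (bundle X (some k)).card + if k = i then 1 else 0 := by
      intro k
      simp only [YankeeSwap.augment, transfer]
      by_cases hk : k = i
      · subst hk
        rw [bundle_update_self, Finset.card_insert_of_notMem (by simp [hb]), if_pos rfl]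
      · rw [bundle_update_of_ne (by simp [hb]) (by simpa using Ne.symm hk), if_neg hk, add_zero]
    rw [List.nil_append]
    refine ⟨fun k => ?_, hcard⟩
    rw [hcard]
    simp only [YankeeSwap.augment, transfer]
    by_cases hk : k = i
    · subst hk
      have : v k (insert b (bundle X (some k))) - v k (bundle X (some k)) = 1 := hd
      rw [bundle_update_self, if_pos rfl]
      push_cast
      linarith [hX k]
    · rw [bundle_update_of_ne (by simp [hb]) (by simpa using Ne.symm hk), if_neg hk, add_zero, hX]
  · rw [List.append_assoc, List.singleton_append] at *
    obtain ⟨hb, hown⟩ := h.last (Q ++ [a]) b (by simp)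
    obtain ⟨hab, hQb⟩ := h.edge Q a b [] rfl
    obtain ⟨k, ha⟩ := Option.ne_none_iff_exists'.1 (hown a (by simp))
    have haQ : a ∉ Q := fun h => hQb a h hab
    have hbQ : b ∉ Q := fun h => hown b (by simp [h]) hb
    have hab' : a ≠ b := fun h => by simp [h, hb] at ha
    have := ih (Q ++ [a]).length (by rw [← hm]; simp) rfl (hX.swapLast ha hb hab) (by simp)
      (h.swapLast hv hX)
    simp only [YankeeSwap.augment, transfer_append_pair hab' haQ hbQ] at this ⊢
    exact ⟨this.1, fun k => by rw [this.2, card_bundle_swapLast ‹_› hb]⟩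

/-! ### Goods that cannot reach an unallocated good -/

theorem mem_of_isChain_of_closed {α : Type*} {r : α → α → Prop} {A : Set α}
    (hA : ∀ a ∈ A, ∀ b, r a b → b ∈ A) : ∀ {P : List α}, P.IsChain r → ∀ {a : α}, a ∈ P →
      a ∈ A → ∀ h : P ≠ [], P.getLast h ∈ A
  | [a], _, b, hb, hbA, _ => by
    simp at hb
    simpa [← hb] using hbA
  | a :: c :: P, hc, b, hb, hbA, _ => by
    rw [List.getLast_cons (by simp)]
    rw [List.isChain_cons_cons] at hc
    rcases List.mem_cons.1 hb with rfl | hb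
    · exact mem_of_isChain_of_closed hA hc.2 (a := c) (by simp) (hA _ hbA c hc.1) _
    · exact mem_of_isChain_of_closed hA hc.2 hb hbA _

open Classical in
/-- The goods from which no unallocated good can be reached in the exchange graph. -/
noncomputable def stuck (v : Fin n → Finset G → ℝ) (X : Allocation n G) : Finset G :=
  Finset.univ.filter fun g => ∀ z, Relation.ReflTransGen (ExchangeEdge v X) g z → X z ≠ none

theorem mem_stuck {g : G} :
    g ∈ stuck v X ↔ ∀ z, Relation.ReflTransGen (ExchangeEdge v X) g z → X z ≠ none := by
  simp [stuck]

theorem ne_none_of_mem_stuck {g : G} (hg : g ∈ stuck v X) : X g ≠ none :=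
  mem_stuck.1 hg g .refl

theorem stuck_closed {g g' : G} (hg : g ∈ stuck v X) (h : ExchangeEdge v X g g') :
    g' ∈ stuck v X :=
  mem_stuck.2 fun z hz => mem_stuck.1 hg z (.head h hz)

theorem not_exists_isTransferPath_iff :
    (¬ ∃ P, IsTransferPath v X i P) ↔ desired v X i ⊆ stuck v X := by
  constructor
  · intro h g hg
    rw [Finset.mem_coe, mem_stuck]
    intro z hz hzn
    obtain ⟨l, hl, hlast⟩ := List.exists_isChain_cons_of_relationReflTransGen hz
    exact h ⟨g :: l, hl, by simp, by simpa using hg, by rw [hlast]; simpa using hzn⟩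
  · rintro h ⟨P, hc, hne, hh, hl⟩
    have := mem_of_isChain_of_closed (A := (stuck v X : Set G))
      (fun a ha b hab => stuck_closed ha hab) hc (List.head_mem hne) (h hh) hne
    exact ne_none_of_mem_stuck this (by simpa using hl)

theorem IsTransferPath.notMem_stuck {P : List G} (hP : IsTransferPath v X i P) {g : G}
    (hg : g ∈ P) : g ∉ stuck v X := by
  obtain ⟨hc, hne, -, hl⟩ := hP
  intro h
  have := mem_of_isChain_of_closed (A := (stuck v X : Set G))
    (fun a ha b hab => stuck_closed ha hab) hc hg h hne
  exact ne_none_of_mem_stuck this (by simpa using hl)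

/-- No edge leaves `A`, so a good outside `A` cannot replace any good of `X_k ∩ A`; this set is
nonempty, so `insert_sdiff_eq` puts the outside good in the closure of `X_k \ A`. -/
theorem val_compl_stuck (hv : ∀ k, IsMatroidRank (v k)) (hX : NonRedundant v X) {g : G}
    {k : Fin n} (hg : g ∈ stuck v X) (hk : X g = some k) :
    v k (stuck v X)ᶜ = (bundle X (some k) \ stuck v X).card := by
  set A := stuck v X with hA
  have hS := (hv k).eq_card_of_subset
    (Finset.sdiff_subset (s := bundle X (some k)) (t := A)) (hX k)
  have h1 : ∀ g' ∈ Aᶜ, v k (insert g' (bundle X (some k) \ A)) =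
      v k (bundle X (some k) \ A) := by
    intro g' hg'
    rw [Finset.mem_compl] at hg'
    rw [← Finset.sdiff_inter_self_left (bundle X (some k)) A]
    refine (hv k).insert_sdiff_eq (hX k) Finset.inter_subset_left
      ⟨g, Finset.mem_inter.2 ⟨by simpa using hk, hg⟩⟩ fun x hx he => hg' ?_
    obtain ⟨hxk, hxA⟩ := Finset.mem_inter.1 hx
    exact stuck_closed hxA
      ((exchangeEdge_iff (by simpa using hxk)).2 ⟨fun h => hg' (h ▸ hxA), he⟩)
  have h2 := (hv k).union_eq_of_forall_insert_eq _ _ h1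
  rwa [Finset.union_eq_right.2 fun x hx => Finset.mem_compl.2 (Finset.mem_sdiff.1 hx).2, hS] at h2

theorem val_union_compl_stuck (hv : ∀ k, IsMatroidRank (v k))
    (hi : desired v X i ⊆ stuck v X) :
    v i (bundle X (some i) ∪ (stuck v X)ᶜ) = v i (bundle X (some i)) := by
  refine (hv i).union_eq_of_forall_insert_eq _ _ fun g hg => ?_
  rcases (hv i).marginal_binary (bundle X (some i)) g with h | h
  · linarith
  · exact absurd (hi h) (Finset.mem_compl.1 hg)

/-- If no path starts from the goods desired by `i`, then this remains so under augmentations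
for other agents. -/
theorem desired_augment_subset_stuck (hv : ∀ k, IsMatroidRank (v k)) (hX : NonRedundant v X)
    {j : Fin n} {P : List G} (hP : IsShortestTransferPath v X j P) (hij : i ≠ j)
    (hi : desired v X i ⊆ stuck v X) :
    desired v (augment X j P) i ⊆ stuck v (augment X j P) := by
  obtain ⟨hX', hcard⟩ := hP.isInduced.augment hv hX hP.1.2.1
  set X' := augment X j P
  set A := stuck v X with hA
  have hown : ∀ g ∈ A, X' g = X g := fun g hg =>
    transfer_of_notMem fun h => hP.1.notMem_stuck h hg
  have hinter : ∀ k, bundle X' (some k) ∩ A = bundle X (some k) ∩ A := by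
    intro k
    ext g
    simp only [Finset.mem_inter, mem_bundle, and_congr_left_iff]
    intro hg
    rw [hown g hg]
  -- A new edge from `g` to `g' ∉ A` would make `(X'_k \ A) + g'` independent outside `A`. But `v k
  -- Aᶜ = |X_k \ A| ≤ |X'_k \ A|`, as `X'_k ∩ A = X_k ∩ A` and no bundle shrinks.
  have hclosed : ∀ g ∈ A, ∀ g', ExchangeEdge v X' g g' → g' ∈ A := by
    intro g hg g' he
    by_contra hg'
    obtain ⟨k, hk⟩ := Option.ne_none_iff_exists'.1 (ne_none_of_mem_stuck hg)
    have hk' : X' g = some k := by rw [hown g hg, hk]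
    rw [exchangeEdge_iff hk'] at he
    have h0 := val_compl_stuck hv hX hg hk
    have h1 := Finset.card_erase_add_one (s := bundle X' (some k)) (a := g) (by simpa using hk')
    -- Otherwise the exchange would merely delete `g`, and the value would drop.
    have hg'X : g' ∉ bundle X' (some k) := by
      intro h
      rw [Finset.insert_eq_of_mem (Finset.mem_erase.2 ⟨he.1, h⟩), hX'] at he
      have h2 := (hv k).le_card ((bundle X' (some k)).erase g)
      rw [he.2] at h2
      norm_cast at h2
      omega
    have hind : v k (insert g' ((bundle X' (some k)).erase g)) =
        (insert g' ((bundle X' (some k)).erase g)).card := by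
      rw [he.2, hX', Finset.card_insert_of_notMem (fun h => hg'X (Finset.mem_of_mem_erase h)), h1]
    have hsub : insert g' (bundle X' (some k) \ A) ⊆
        insert g' ((bundle X' (some k)).erase g) := by
      refine Finset.insert_subset_insert _ fun x hx => ?_
      rw [Finset.mem_sdiff] at hx
      exact Finset.mem_erase.2 ⟨fun h => hx.2 (h ▸ hg), hx.1⟩
    have h3 := (hv k).eq_card_of_subset hsub hind
    rw [Finset.card_insert_of_notMem (fun h => hg'X (Finset.mem_sdiff.1 h).1)] at h3
    have h4 : v k (insert g' (bundle X' (some k) \ A)) ≤ v k Aᶜ := by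
      refine (hv k).mono (Finset.insert_subset (Finset.mem_compl.2 hg') fun x hx => ?_)
      exact Finset.mem_compl.2 (Finset.mem_sdiff.1 hx).2
    rw [h3, h0, ← hA] at h4
    norm_cast at h4
    have h5 := Finset.card_sdiff_add_card_inter (bundle X' (some k)) A
    have h6 := Finset.card_sdiff_add_card_inter (bundle X (some k)) A
    rw [hinter] at h5
    have h7 := hcard k
    split_ifs at h7 <;> omega
  intro g hg
  -- Otherwise `X'_i + g` lies in `X_i ∪ Aᶜ`, whose value is only `|X_i| = |X'_i|`.
  have hgA : g ∈ A := by
    by_contra hgA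
    have hg1 : v i (insert g (bundle X' (some i))) - v i (bundle X' (some i)) = 1 := hg
    have h1 : insert g (bundle X' (some i)) ⊆ bundle X (some i) ∪ Aᶜ := by
      intro x hx
      rw [Finset.mem_union, Finset.mem_compl]
      by_cases hxA : x ∈ A
      · rw [Finset.mem_insert] at hx
        left
        rcases hx with rfl | hx
        · exact absurd hxA hgA
        · rw [mem_bundle] at hx ⊢
          rw [← hown x hxA, hx]
      · exact Or.inr hxA
    have h2 := (hv i).mono h1
    rw [val_union_compl_stuck hv hi, hX i] at h2
    rw [hX' i, hcard i, if_neg hij, add_zero] at hg1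
    linarith
  refine mem_stuck.2 fun z hz => ?_
  have hzA : z ∈ A := by
    induction hz with
    | refl => exact hgA
    | tail _ h ih => exact hclosed _ ih _ h
  rw [hown z hzA]
  exact ne_none_of_mem_stuck hzA

/-! ### The optimality certificate -/

theorem sum_card_bundle_inter (Y : Allocation n G) (A : Finset G) :
    ∑ k, (bundle Y (some k) ∩ A).card + (bundle Y none ∩ A).card = A.card := by
  rw [Finset.card_eq_sum_card_fiberwise (s := A) (f := Y) (t := Finset.univ) (by simp),
    Fintype.sum_option, add_comm]
  congr 1
  · congr 1
    ext g
    simp [and_comm]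
  · refine Finset.sum_congr rfl fun k _ => ?_
    congr 1
    ext g
    simp [and_comm]

theorem isMaxUSW_of_desired_subset_stuck (hv : ∀ k, IsMatroidRank (v k))
    (hX : NonRedundant v X) (h : ∀ k, desired v X k ⊆ stuck v X) : IsMaxUSW v X := by
  intro Y
  set A := stuck v X with hA
  -- An agent owning no good of `A` has its whole bundle in `Aᶜ`, and that bundle spans `Aᶜ` because
  -- nothing there is desired.
  have hval : ∀ k, v k Aᶜ ≤ (bundle X (some k) \ A).card := by
    intro k
    by_cases hk : ∃ g ∈ A, X g = some k
    · obtain ⟨g, hg, hk⟩ := hk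
      exact (val_compl_stuck hv hX hg hk).le
    · have h1 : bundle X (some k) \ A = bundle X (some k) :=
        Finset.sdiff_eq_self_of_disjoint (Finset.disjoint_left.2 fun g hg hgA =>
          hk ⟨g, hgA, by simpa using hg⟩)
      rw [h1, ← hX k, ← val_union_compl_stuck hv (h k)]
      exact (hv k).mono Finset.subset_union_right
  have hY : (∑ k, ((bundle Y (some k) ∩ A).card : ℝ)) ≤ A.card := by
    have := sum_card_bundle_inter Y A
    exact_mod_cast (by omega)
  have hXA : (∑ k, ((bundle X (some k) ∩ A).card : ℝ)) = A.card := by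
    have h1 := sum_card_bundle_inter X A
    have h2 : bundle X none ∩ A = ∅ := by
      ext g
      simp only [Finset.mem_inter, mem_bundle, Finset.notMem_empty, iff_false, not_and]
      exact fun h1 h2 => ne_none_of_mem_stuck h2 h1
    rw [h2, Finset.card_empty, add_zero] at h1
    exact_mod_cast h1
  calc usw v Y ≤ ∑ k, (((bundle X (some k) \ A).card : ℝ) + (bundle Y (some k) ∩ A).card) := by
        refine Finset.sum_le_sum fun k _ => ?_
        have h1 := (hv k).le_sdiff_add_card_inter (bundle Y (some k)) A
        have h2 : v k (bundle Y (some k) \ A) ≤ v k Aᶜ :=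
          (hv k).mono fun x hx => Finset.mem_compl.2 (Finset.mem_sdiff.1 hx).2
        have h3 := hval k
        simp only [utility]
        linarith
    _ ≤ ∑ k, (((bundle X (some k) \ A).card : ℝ) + (bundle X (some k) ∩ A).card) := by
        rw [Finset.sum_add_distrib, Finset.sum_add_distrib, hXA]
        linarith
    _ = usw v X := by
        refine Finset.sum_congr rfl fun k _ => ?_
        rw [utility, hX k]
        exact_mod_cast Finset.card_sdiff_add_card_inter (bundle X (some k)) A

/-- The invariant of General Yankee Swap: the allocation is non-redundant, and no path starts
from the goods desired by an agent that was removed. -/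
structure State.Invariant (v : Fin n → Finset G → ℝ) (s : State n G) : Prop where
  nonRedundant : NonRedundant v s.alloc
  inactive : ∀ k ∉ s.active, desired v s.alloc k ⊆ stuck v s.alloc

/-- The number of unallocated goods plus the number of active agents. -/
def State.size (s : State n G) : ℕ :=
  (bundle s.alloc none).card + s.active.card

/-! ### Runs of the algorithm: invariant, termination, existence of an output -/

variable {b : ℕ} {φ : (Fin n → ℝ) → Fin n → Fin b → ℝ} {s t : State n G}

theorem invariant_initial (hv : ∀ k, IsMatroidRank (v k)) : (initial n G).Invariant v where
  nonRedundant k := by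
    have : bundle (initial n G).alloc (some k) = ∅ := by
      ext g
      simp [initial]
    rw [this, (hv k).map_empty, Finset.card_empty, Nat.cast_zero]
  inactive k hk := by simp [initial] at hk

theorem Step.invariant (hv : ∀ k, IsMatroidRank (v k)) (hst : Step v φ s t)
    (hs : s.Invariant v) : t.Invariant v := by
  cases hst with
  | swap i P hi hP =>
    refine ⟨(hP.isInduced.augment hv hs.nonRedundant hP.1.2.1).1, fun k hk => ?_⟩
    exact desired_augment_subset_stuck hv hs.nonRedundant hP (fun h => hk (h ▸ hi.1.1))
      (hs.inactive k hk)
  | remove i hi hP =>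
    refine ⟨hs.nonRedundant, fun k hk => ?_⟩
    by_cases hki : k = i
    · subst hki
      exact not_exists_isTransferPath_iff.1 hP
    · exact hs.inactive k fun h => hk (Finset.mem_erase.2 ⟨hki, h⟩)

/-- A swap enlarges exactly one agent's bundle, by one good, so it uses up one unallocated good; a
removal uses up one active agent. -/
theorem Step.size_lt (hv : ∀ k, IsMatroidRank (v k)) (hst : Step v φ s t)
    (hs : s.Invariant v) : t.size < s.size := by
  cases hst with
  | swap i P hi hP =>
    have hcard := (hP.isInduced.augment hv hs.nonRedundant hP.1.2.1).2
    have h1 := sum_card_bundle_inter (augment s.alloc i P) Finset.univ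
    have h2 := sum_card_bundle_inter s.alloc Finset.univ
    simp only [Finset.inter_univ, hcard, Finset.sum_add_distrib, Finset.sum_ite_eq',
      Finset.mem_univ, if_true] at h1 h2
    simp only [State.size]
    omega
  | remove i hi hP =>
    have := Finset.card_erase_lt_of_mem hi.1.1
    simp only [State.size]
    omega

theorem exists_isChosen (hs : s.active.Nonempty) : ∃ i, IsChosen v φ s i := by
  classical
  obtain ⟨k, hk, hmax⟩ := s.active.exists_max_image
    (fun k => toLex (φ (utility v s.alloc) k)) hs
  set S := {k | k ∈ s.active ∧ ∀ j ∈ s.active,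
    toLex (φ (utility v s.alloc) j) ≤ toLex (φ (utility v s.alloc) k)} with hS
  have hne : S.toFinset.Nonempty := ⟨k, by simpa [hS] using ⟨hk, hmax⟩⟩
  exact ⟨S.toFinset.min' hne, by simpa [IsChosen] using S.toFinset.isLeast_min' hne⟩

theorem exists_isShortestTransferPath (h : ∃ P, IsTransferPath v X i P) :
    ∃ P, IsShortestTransferPath v X i P := by
  obtain ⟨P, hP, hmin⟩ := (measure (List.length (α := G))).wf.has_min
    {P | IsTransferPath v X i P} h
  exact ⟨P, hP, fun Q hQ => not_lt.1 (hmin Q hQ)⟩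

theorem exists_step (hs : s.active.Nonempty) : ∃ t, Step v φ s t := by
  obtain ⟨i, hi⟩ := exists_isChosen (v := v) (φ := φ) hs
  by_cases h : ∃ P, IsTransferPath v s.alloc i P
  · obtain ⟨P, hP⟩ := exists_isShortestTransferPath h
    exact ⟨_, .swap s i P hi hP⟩
  · exact ⟨_, .remove s i hi h⟩

theorem exists_reflTransGen_step (hv : ∀ k, IsMatroidRank (v k)) (hs : s.Invariant v) :
    ∃ X, Relation.ReflTransGen (Step v φ) s ⟨X, ∅⟩ := by
  induction hm : s.size using Nat.strong_induction_on generalizing s with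
  | _ m ih =>
    rcases s.active.eq_empty_or_nonempty with h | h
    · exact ⟨s.alloc, by rw [← h]⟩
    · obtain ⟨t, ht⟩ := exists_step (v := v) (φ := φ) h
      obtain ⟨X, hX⟩ := ih t.size (hm ▸ ht.size_lt hv hs) (ht.invariant hv hs) rfl
      exact ⟨X, .head ht hX⟩

theorem invariant_of_reflTransGen (hv : ∀ k, IsMatroidRank (v k))
    (h : Relation.ReflTransGen (Step v φ) s t) (hs : s.Invariant v) : t.Invariant v := by
  induction h with
  | refl => exact hs
  | tail _ h ih => exact h.invariant hv ih

end YankeeSwap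

theorem mainTheorem3 {n b : ℕ} {G : Type*} [Fintype G] [DecidableEq G]
    (v : Fin n → Finset G → ℝ) (hv : ∀ i, YankeeSwap.IsMatroidRank (v i))
    (φ : (Fin n → ℝ) → Fin n → Fin b → ℝ) :
    (¬ ∃ s : ℕ → YankeeSwap.State n G,
      s 0 = YankeeSwap.initial n G ∧ ∀ t, YankeeSwap.Step v φ (s t) (s (t + 1))) ∧
    (∃ X : YankeeSwap.Allocation n G, YankeeSwap.IsOutput v φ X) ∧
    ∀ X : YankeeSwap.Allocation n G,
      YankeeSwap.IsOutput v φ X → YankeeSwap.IsMaxUSW v X := by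
  have h0 := YankeeSwap.invariant_initial hv
  refine ⟨?_, YankeeSwap.exists_reflTransGen_step hv h0, fun X hX => ?_⟩
  · rintro ⟨s, hs0, hs⟩
    have hinv : ∀ t, (s t).Invariant v := by
      intro t
      induction t with
      | zero => rwa [hs0]
      | succ t ih => exact (hs t).invariant hv ih
    obtain ⟨t, ht⟩ := WellFounded.not_rel_apply_succ (r := (· < ·)) fun t => (s t).size
    exact ht ((hs t).size_lt hv (hinv t))
  · have h := YankeeSwap.invariant_of_reflTransGen hv hX h0
    exact YankeeSwap.isMaxUSW_of_desired_subset_stuck hv h.nonRedundant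
      fun k => h.inactive k (Finset.notMem_empty k)
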